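/- **Setting.** Let $c=(c_1,\dots,c_k)$ be a composition of $n$, and let $\mathfrak p\subset\mathfrak{sl}(n,\mathbb C)$ be the standard (block upper triangular) parabolic subalgebra with diagonal blocks of sizes $c_1,\dots,c_k$ and nilradical $\mathfrak m$. Let $x_{i,j}$ be the matrix units and let $\mathfrak n=\bigoplus_{i<j}\mathbb C x_{i,j}$. The diagram of $c$ has columns $C_1,\dots,C_k$ (left to right), $C_j$ having $c_j$ boxes, in rows $R_1,\dots,R_{c_j}$ (top to bottom). Its boxes are numbered $1,\dots,n$ down the columns, from left to right, which gives the tableau $\mathscr T_{\mathfrak m}$. A line from a box $i$ to a box $j$ in a column strictly to its right represents $x_{i,j}\in\mathfrak m$. Two columns of the same height $s$ are *neighbouring* if no column of height $s$ lies strictly between them; the left one is then the left neighbour of the right one. For boxes, $b<b'$ (resp. $b\le b'$) means that the column of $b$ is strictly to the left of (resp. strictly to the left of, or equal to) that of $b'$; we compare boxes with columns in the same way. **The labelled lines (maximal gating).** *Stage $0$.* Join any two boxes on the same row with no box of that row strictly between them by a horizontal line. The line with right end $y\in R_r\cap C$ is labelled $*$ if $C$ has height $r$ and has a left neighbour; otherwise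 it is labelled $1$. No line is gated. *Stage $i$* ($i=1,2,\dots$). Let $b_1 - b_1',\ \dots,\ b_u - b_u'$ be the lines labelled $*$ which are not yet gated and lie in $R_1\cup\dots\cup R_{i-1}$, ordered from left to right (one has $b_1<b'_1\le b_2<b_2'\le\dots\le b_u<b'_u$). Gate all of them. Consider the columns of height $\ge i$. * Delete the horizontal line in $R_i$ joining two consecutive such columns $D,D'$ whenever $D\le b_j<b'_j\le D'$ for some $j$. * (i) For each box $y$ of $R_i$ which is the leftmost box of $R_i$ or the right end of a deleted line, join $b_m$ to $y$, where $m$ is maximal with $b_m<y$ (if such an $m$ exists). For each box $y$ of $R_i$ which is the rightmost box of $R_i$ or the left end of a deleted line, join $y$ to $b'_m$, where $m$ is minimal with $y<b'_m$ (if such an $m$ exists). * (ii) Then join $b_j$ to $b'_{j+1}$ for each $j\in[1,u-1]$ such that $b_j$ was not given a right going line in (i). * A new line from some $b_m$ to the right end $y$ of a deleted line labelled $*$ is labelled $*$. All other new lines are labelled $1$. After the stage following the maximal column height the system of lines no longer changes. In this final system let $e$ be the sum of the $x_{i,j}$ over all lines $(i,j)$ labelled $1$, and let $E$ be the span of the $x_{i,j}$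 occurring in $e$. **The space $\mathfrak u_{\pi'}$.** Let $(C,C')$ be a pair of neighbouring columns of height $s$, with $C$ on the left. Let $D_1,\dots,D_m$ be the columns of height $>s$ strictly between them, from left to right, and put $D_0=C$, $D_{m+1}=C'$. Modify $\mathscr T_{\mathfrak m}$ by moving, for $1\le j\le m$, the part of $D_j$ strictly below row $R_s$ to the column $D_{j-1}$ (keeping the rows), and by moving the lowest entry of $C'$ to row $R_{s+1}$ of $D_m$; all other entries stay in place. Let $w=w_{C,C'}\in S_n$ be the permutation whose word form $[w(1),\dots,w(n)]$ is obtained by reading the columns of the new tableau from left to right, each of them from bottom to top. Put $\mathfrak u_{C,C'}=\mathfrak n\cap w(\mathfrak n)$, where $w(x_{i,j})=x_{w(i),w(j)}$. A coordinate $(i,j)$, $i<j$, is called *excluded* from $\mathfrak u_{C,C'}$ if $x_{i,j}\notin\mathfrak u_{C,C'}$. Let $\mathfrak u_{\pi'}\subset\mathfrak m$ be the intersection, in $\mathfrak m$, of the $\mathfrak u_{C,C'}$ over all pairs of neighbouring columns (so $\mathfrak u_{\pi'}=\mathfrak m$ if there are none). **Proposition.** For every composition $c$ of $n$ one has $E\subset\mathfrak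 u_{\pi'}$. Equivalently, if $(i,j)$ is a line labelled $1$ in the final system, then $(i,j)$ is not an excluded coordinate of $\mathfrak u_{C,C'}$, for any pair $(C,C')$ of neighbouring columns. -/

import Mathlib

/-!
A parabolic subalgebra of `sl(n)` is given by a composition `c = (c₁, …, c_k)` of `n`. Its diagram
has columns of heights `c₁, …, c_k` (all starting in the top row), and the tableau `𝒯_𝔪` numbers
the boxes by `0, …, n - 1` down the columns, from left to right. A box is identified with its
entry in `𝒯_𝔪`, an element of `Fin n`. Rows are numbered from `1`, top to bottom.
-/

namespace MaxGating

variable {n : ℕ}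

/-! ### The tableau -/

/-- The column of `𝒯_𝔪` which contains the box `x`. -/
def col (c : Composition n) (x : Fin n) : Fin c.length := c.index x

/-- The row of `𝒯_𝔪` which contains the box `x`; the top row has number `1`. -/
def row (c : Composition n) (x : Fin n) : ℕ := (c.invEmbedding x : ℕ) + 1

/-- The height of a column. -/
def ht (c : Composition n) (j : Fin c.length) : ℕ := c.blocksFun j

/-- `p`, `q` (with `p` on the left) is a pair of neighbouring columns: they have the same height,
and no column of that height lies strictly between them. -/
abbrev Neighbours (c : Composition n) (p q : Fin c.length) : Prop :=
  p < q ∧ ht c p = ht c q ∧ ∀ j, p < j → j < q → ht c j ≠ ht c p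

/-- The boxes `x`, `y` (with `x` on the left) lie on the same row and no box of that row lies
strictly between them. -/
abbrev Adjacent (c : Composition n) (x y : Fin n) : Prop :=
  row c x = row c y ∧ col c x < col c y ∧
    ∀ z, row c z = row c x → ¬ (col c x < col c z ∧ col c z < col c y)

/-! ### The maximal-gating construction -/

/-- A system of labelled lines on the tableau. A line is recorded as the pair
(left end box, right end box): `ones` are the lines labelled `1`, `stars` the lines labelled `*`,
and `gated` those lines labelled `*` which have been gated so far. -/
structure Lines (n : ℕ) where
  /-- the lines labelled `1` -/
  ones : Finset (Fin n × Fin n)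
  /-- the lines labelled `*` -/
  stars : Finset (Fin n × Fin n)
  /-- the gated lines -/
  gated : Finset (Fin n × Fin n)

/-- In the rightmost labelling, the horizontal line from `x` to the adjacent box `y` is labelled
`*` exactly when `y` is the lowest box of its column and that column has a left neighbour. -/
abbrev InitStar (c : Composition n) (l : Fin n × Fin n) : Prop :=
  Adjacent c l.1 l.2 ∧ row c l.2 = ht c (col c l.2) ∧ ∃ p, Neighbours c p (col c l.2)

/-- Stage `0`: all pairs of adjacent boxes are joined, with the rightmost labelling. -/
def initial (c : Composition n) : Lines n where
  ones := Finset.univ.filter fun l => Adjacent c l.1 l.2 ∧ ¬ InitStar c l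
  stars := Finset.univ.filter fun l => InitStar c l
  gated := ∅

/-- The ungated lines labelled `*` lying in the rows `R_1, …, R_{i-1}`, that is, the lines
`b_1 — b_1', …, b_u — b_u'` to be gated at stage `i`. -/
def ungated (c : Composition n) (i : ℕ) (S : Lines n) : Finset (Fin n × Fin n) :=
  (S.stars \ S.gated).filter fun l => row c l.1 < i ∧ row c l.2 < i

/-- The horizontal lines in `R_i` to be deleted at stage `i`: those which join two adjacent boxes
of `R_i` (thus two consecutive columns among the columns of height `≥ i`) between whose columns
there is at least one ungated line. In the labelling `C_0, C_1, …, C_{2n+1}` of columns of height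
`≥ i` these are the lines from `C_j` to `C_{j+1}`, `j` odd. -/
def deleted (c : Composition n) (i : ℕ) (S : Lines n) : Finset (Fin n × Fin n) :=
  Finset.univ.filter fun d => Adjacent c d.1 d.2 ∧ row c d.1 = i ∧
    ∃ l ∈ ungated c i S, col c d.1 ≤ col c l.1 ∧ col c l.2 ≤ col c d.2

/-- The box `y` of `R_i` has no left going line in `R_i` after the deletion: `y = b''_j` with `j`
even (the leftmost box `b''_0` of `R_i`, or the right end of a deleted line). -/
abbrev FreeLeft (c : Composition n) (i : ℕ) (S : Lines n) (y : Fin n) : Prop :=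
  row c y = i ∧ ∀ x, Adjacent c x y → (x, y) ∈ deleted c i S

/-- The box `x` of `R_i` has no right going line in `R_i` after the deletion: `x = b''_j` with `j`
odd (the rightmost box of `R_i`, or the left end of a deleted line). -/
abbrev FreeRight (c : Composition n) (i : ℕ) (S : Lines n) (x : Fin n) : Prop :=
  row c x = i ∧ ∀ y, Adjacent c x y → (x, y) ∈ deleted c i S

/-- Rule (i), `j` even: join `b_{u_j}` to `b''_j`, where `u_j` is maximal such that
`b_{u_j} < b''_j` (nothing is joined if there is no such index). -/
def joinEven (c : Composition n) (i : ℕ) (S : Lines n) : Finset (Fin n × Fin n) :=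
  Finset.univ.filter fun l => FreeLeft c i S l.2 ∧
    (∃ m ∈ ungated c i S, m.1 = l.1) ∧ col c l.1 < col c l.2 ∧
    ∀ m ∈ ungated c i S, col c m.1 < col c l.2 → col c m.1 ≤ col c l.1

/-- Rule (i), `j` odd: join `b''_j` to `b'_{u'_j}`, where `u'_j` is minimal such that
`b''_j < b'_{u'_j}` (nothing is joined if there is no such index). -/
def joinOdd (c : Composition n) (i : ℕ) (S : Lines n) : Finset (Fin n × Fin n) :=
  Finset.univ.filter fun l => FreeRight c i S l.1 ∧
    (∃ m ∈ ungated c i S, m.2 = l.2) ∧ col c l.1 < col c l.2 ∧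
    ∀ m ∈ ungated c i S, col c l.1 < col c m.2 → col c l.2 ≤ col c m.2

/-- Rule (ii): join `b_j` to `b'_{j+1}` for consecutive ungated lines `b_j — b_j'` and
`b_{j+1} — b_{j+1}'`, unless `b_j` has already received a right going line from rule (i). -/
def joinLoose (c : Composition n) (i : ℕ) (S : Lines n) : Finset (Fin n × Fin n) :=
  Finset.univ.filter fun l => ∃ m ∈ ungated c i S, ∃ m' ∈ ungated c i S,
    l = (m.1, m'.2) ∧ col c m.1 < col c m'.1 ∧
    (∀ k ∈ ungated c i S, ¬ (col c m.1 < col c k.1 ∧ col c k.1 < col c m'.1)) ∧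
    ∀ y, (m.1, y) ∉ joinEven c i S

/-- The new lines which are labelled `*`: when a deleted line `b''_j — b''_{j+1}` was labelled
`*`, the line `b_{u_{j+1}} — b''_{j+1}` which replaces it is labelled `*`. -/
def newStars (c : Composition n) (i : ℕ) (S : Lines n) : Finset (Fin n × Fin n) :=
  (joinEven c i S).filter fun l => ∃ x, (x, l.2) ∈ deleted c i S ∧ (x, l.2) ∈ S.stars

/-- The passage from stage `i - 1` to stage `i`. All new lines other than `newStars` are
labelled `1`. -/
def performStage (c : Composition n) (i : ℕ) (S : Lines n) : Lines n where
  ones := (S.ones \ deleted c i S) ∪ (joinEven c i S \ newStars c i S) ∪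
    joinOdd c i S ∪ joinLoose c i S
  stars := (S.stars \ deleted c i S) ∪ newStars c i S
  gated := S.gated ∪ ungated c i S

/-- The system of labelled lines after stage `i`. -/
def stage (c : Composition n) : ℕ → Lines n
  | 0 => initial c
  | i + 1 => performStage c (i + 1) (stage c i)

/-- The final system of labelled lines. Columns have height at most `n`; in the stage following
the maximal height only rule (ii) acts, and later stages change nothing, so that stage `n + 1` is
the end of the construction. -/
def finalLines (c : Composition n) : Lines n := stage c (n + 1)

/-! ### The element `e` and the space `E` -/

/-- The matrix unit `x_{i,j}`. -/
noncomputable def unitVec (i j : Fin n) : Matrix (Fin n) (Fin n) ℂ := Matrix.single i j 1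

/-- The element `e`: the sum of the `x_{i,j}` over the lines `(i, j)` labelled `1`. -/
noncomputable def e (c : Composition n) : Matrix (Fin n) (Fin n) ℂ :=
  ∑ l ∈ (finalLines c).ones, unitVec l.1 l.2

/-- The span `E` of the root vectors occurring in `e`. -/
noncomputable def spanE (c : Composition n) : Submodule ℂ (Matrix (Fin n) (Fin n) ℂ) :=
  Submodule.span ℂ {x | ∃ i j, e c i j ≠ 0 ∧ x = unitVec i j}

/-! ### Column shifting and the spaces `𝔲` -/

/-- For a pair `p`, `q` of neighbouring columns of height `s`, the boxes which change column when
the tableau is shifted: those strictly below row `R_s` in the columns strictly between `p` and `q`,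
and the lowest box of column `q`. -/
abbrev Moves (c : Composition n) (p q : Fin c.length) (x : Fin n) : Prop :=
  (p < col c x ∧ col c x < q ∧ ht c p < row c x) ∨ (col c x = q ∧ row c x = ht c q)

/-- The column of the entry `x` in the shifted tableau attached to the neighbouring columns
`p`, `q` of height `s`: a moving box goes to the nearest column of height `≥ s` on its left. -/
def shiftCol (c : Composition n) (p q : Fin c.length) (x : Fin n) : ℕ :=
  if Moves c p q x then
    (Finset.univ.filter fun j => j < col c x ∧ ht c p ≤ ht c j).sup fun j => (j : ℕ)
  else (col c x : ℕ)

/-- The row of the entry `x` in the shifted tableau: the lowest box of column `q` goes from row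
`R_s` to row `R_{s+1}`, all other boxes stay in their row. -/
def shiftRow (c : Composition n) (q : Fin c.length) (x : Fin n) : ℕ :=
  if col c x = q ∧ row c x = ht c q then ht c q + 1 else row c x

/-- The permutation `w_c(𝒯)` of a tableau `𝒯`, given by the column and the row of each entry. Its
word form `w 0, w 1, …` lists the entries column by column from left to right, each column being
read from bottom to top. -/
def columnWord (colOf rowOf : Fin n → ℕ) : Equiv.Perm (Fin n) :=
  Tuple.sort fun x => (toLex (colOf x, OrderDual.toDual (rowOf x)) : ℕ ×ₗ ℕᵒᵈ)

/-- The element of the Weyl group attached to the neighbouring columns `p`, `q`. -/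
def weylElt (c : Composition n) (p q : Fin c.length) : Equiv.Perm (Fin n) :=
  columnWord (shiftCol c p q) (shiftRow c q)

/-- `𝔫`, the span of the root vectors `x_{i,j}`, `i < j`. -/
noncomputable def nilN (n : ℕ) : Submodule ℂ (Matrix (Fin n) (Fin n) ℂ) :=
  Submodule.span ℂ {x | ∃ i j : Fin n, i < j ∧ x = unitVec i j}

/-- `𝔪`, the nilradical of the parabolic subalgebra: the span of the `x_{i,j}` such that the
block of `i` precedes the block of `j`. -/
noncomputable def nilM (c : Composition n) : Submodule ℂ (Matrix (Fin n) (Fin n) ℂ) :=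
  Submodule.span ℂ {x | ∃ i j : Fin n, col c i < col c j ∧ x = unitVec i j}

/-- `𝔫 ∩ w(𝔫)`, where `w` sends `x_{i,j}` to `x_{w i, w j}`. -/
noncomputable def nilInter (w : Equiv.Perm (Fin n)) : Submodule ℂ (Matrix (Fin n) (Fin n) ℂ) :=
  nilN n ⊓ (nilN n).map (Matrix.reindexLinearEquiv ℂ ℂ w w).toLinearMap

/-- The space `𝔲_i = 𝔫 ∩ w_i(𝔫)` attached to a pair of neighbouring columns. -/
noncomputable def uPair (c : Composition n) (p q : Fin c.length) :
    Submodule ℂ (Matrix (Fin n) (Fin n) ℂ) :=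
  nilInter (weylElt c p q)

/-- `𝔲_{π'}`: the intersection of the `𝔲_i` over all pairs of neighbouring columns, taken in `𝔪`
(so that it is `𝔪` when there are no neighbouring columns). -/
noncomputable def uPi (c : Composition n) : Submodule ℂ (Matrix (Fin n) (Fin n) ℂ) :=
  nilM c ⊓ ⨅ (p : Fin c.length) (q : Fin c.length) (_ : Neighbours c p q), uPair c p q

/-- The coordinate `(i, j)` is excluded from `𝔲_{p,q}`: the root vector `x_{i,j}` of `𝔫` does not
lie in `𝔲_{p,q}`. -/
def Excluded (c : Composition n) (p q : Fin c.length) (i j : Fin n) : Prop :=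
  i < j ∧ unitVec i j ∉ uPair c p q

end MaxGating

namespace MaxGating

variable {n : ℕ}

/-! ### Boxes and columns -/

/-! Let s be the common height of a neighbouring pair. The matrix unit of a line from x to y lies in
the space of the pair as soon as x is still in a column strictly left of y after the shift
(`shiftCol_lt_shiftCol`, `columnWord_symm_lt`). This can fail only if y moves, x is in a row ≤ s,
and no column of height ≥ s separates them: this is `Crosses`.

That no line labelled 1 crosses is proved by induction over the stages (`StageInvariant`). The `*`
lines gated at stage i + 1 are those ending in row i; each ends at the bottom of a column of height
i and passes over smaller columns only. For every new line, either such a column blocks the crossing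
or an end lies in the wrong row, with one exception: a new line from rule (i) ending at the bottom
of the right column of a pair. That line replaces a deleted `*` line and inherits the label `*`. -/

theorem one_le_row (c : Composition n) (x : Fin n) : 1 ≤ row c x := by
  unfold row; omega

theorem row_le_ht (c : Composition n) (x : Fin n) : row c x ≤ ht c (col c x) :=
  (c.invEmbedding x).isLt

theorem exists_box (c : Composition n) (j : Fin c.length) (r : ℕ) (h1 : 1 ≤ r)
    (h2 : r ≤ ht c j) : ∃ x, col c x = j ∧ row c x = r := by
  have hr : r - 1 < c.blocksFun j := by unfold ht at h2; omega
  refine ⟨c.embedding j ⟨r - 1, hr⟩, c.index_embedding j _, ?_⟩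
  unfold row
  rw [c.invEmbedding_comp]
  simp only
  omega

theorem box_ext (c : Composition n) {x y : Fin n} (h1 : col c x = col c y)
    (h2 : row c x = row c y) : x = y := by
  apply Fin.ext
  have hx := c.coe_invEmbedding x
  have hy := c.coe_invEmbedding y
  have hx' := c.sizeUpTo_index_le x
  have hy' := c.sizeUpTo_index_le y
  unfold col at h1
  unfold row at h2
  have h3 := congrArg (fun j : Fin c.length => c.sizeUpTo j) h1
  omega

theorem lt_of_col_lt (c : Composition n) {x y : Fin n} (h : col c x < col c y) : x < y := by
  have h1 := c.lt_sizeUpTo_index_succ x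
  have h2 := c.sizeUpTo_index_le y
  have h3 : c.sizeUpTo (c.index x).succ ≤ c.sizeUpTo (c.index y) :=
    c.monotone_sizeUpTo (Nat.succ_le_of_lt h)
  exact Fin.lt_def.2 (lt_of_lt_of_le h1 (h3.trans h2))

theorem Adjacent.ht_lt {c : Composition n} {x y : Fin n} (h : Adjacent c x y)
    {k : Fin c.length} (h1 : col c x < k) (h2 : k < col c y) : ht c k < row c x := by
  by_contra! hk
  obtain ⟨z, rfl, hz⟩ := exists_box c k _ (one_le_row c x) hk
  exact h.2.2 z hz ⟨h1, h2⟩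

theorem Adjacent.col_eq {c : Composition n} {x x' y : Fin n} (h : Adjacent c x y)
    (h' : Adjacent c x' y) : col c x = col c x' := by
  rcases lt_trichotomy (col c x) (col c x') with hl | he | hl
  · exact absurd ⟨hl, h'.2.1⟩ (h.2.2 x' (h'.1.trans h.1.symm))
  · exact he
  · exact absurd ⟨hl, h.2.1⟩ (h'.2.2 x (h.1.trans h'.1.symm))

theorem exists_adjacent {c : Composition n} {x y : Fin n} (hr : row c x = row c y)
    (hc : col c x < col c y) : ∃ z, Adjacent c z y := by
  classical
  obtain ⟨z, hz, hmax⟩ := Finset.exists_max_image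
    (Finset.univ.filter fun z => row c z = row c y ∧ col c z < col c y) (col c)
    ⟨x, by simp [hr, hc]⟩
  simp only [Finset.mem_filter, Finset.mem_univ, true_and] at hz hmax
  exact ⟨z, hz.1, hz.2, fun w hw h => (hmax w ⟨hw.trans hz.1, h.2⟩).not_gt h.1⟩

/-! ### Crossing a column shift -/

/-- The shift attached to the neighbouring columns `p`, `q` moves the box `y` to, or to the left
of, the column of `x`, while `x` itself does not move. -/
def Crosses (c : Composition n) (p q : Fin c.length) (x y : Fin n) : Prop :=
  Moves c p q y ∧ row c x ≤ ht c p ∧ ∀ k, col c x < k → k < col c y → ht c k < ht c p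

theorem shiftCol_le (c : Composition n) (p q : Fin c.length) (x : Fin n) :
    shiftCol c p q x ≤ col c x := by
  unfold shiftCol
  split_ifs with h
  · refine Finset.sup_le fun j hj => ?_
    exact (Fin.lt_def.1 (Finset.mem_filter.1 hj).2.1).le
  · exact le_rfl

theorem lt_col_of_moves {c : Composition n} {p q : Fin c.length} (hpq : p < q) {x : Fin n}
    (h : Moves c p q x) : p < col c x := by
  rcases h with h | h
  · exact h.1
  · exact h.1 ▸ hpq

theorem shiftCol_lt_of_moves {c : Composition n} {p q : Fin c.length} (hpq : p < q) {x : Fin n}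
    (h : Moves c p q x) : shiftCol c p q x < col c x := by
  have hp := lt_col_of_moves hpq h
  unfold shiftCol
  -- An empty supremum is 0, so strictness needs a column to the left of x; p is one.
  rw [if_pos h, Finset.sup_lt_iff (lt_of_le_of_lt (Nat.zero_le _) (Fin.lt_def.1 hp))]
  exact fun j hj => Fin.lt_def.1 (Finset.mem_filter.1 hj).2.1

theorem le_shiftCol_of_moves {c : Composition n} {p q j : Fin c.length} {x : Fin n}
    (h : Moves c p q x) (hj : j < col c x) (hs : ht c p ≤ ht c j) :
    (j : ℕ) ≤ shiftCol c p q x := by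
  unfold shiftCol
  rw [if_pos h]
  exact Finset.le_sup (f := fun j : Fin c.length => (j : ℕ)) (by simp [hj, hs])

/-- Only a moving y can be overtaken. It lands no further left than any column of height ≥ s before
it, so a separating column suffices. Without one, x lies below row s: either x is left of p, where y
cannot pass p, or x moves strictly left while y stops at the old column of x or beyond. -/
theorem shiftCol_lt_shiftCol {c : Composition n} {p q : Fin c.length} (hpq : Neighbours c p q)
    {x y : Fin n} (hxy : col c x < col c y) (h : ¬ Crosses c p q x y) :
    shiftCol c p q x < shiftCol c p q y := by
  by_cases hy : Moves c p q y
  · have hpy := lt_col_of_moves hpq.1 hy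
    by_cases hk : ∀ k, col c x < k → k < col c y → ht c k < ht c p
    · have hrow : ht c p < row c x := by
        by_contra! hr
        exact h ⟨hy, hr, hk⟩
      rcases lt_trichotomy (col c x) p with hl | he | hl
      · exact lt_of_le_of_lt (shiftCol_le c p q x)
          (lt_of_lt_of_le (Fin.lt_def.1 hl) (le_shiftCol_of_moves hy hpy le_rfl))
      · exact absurd (row_le_ht c x) (by rw [he]; omega)
      · have hyq : col c y ≤ q := by
          rcases hy with hy | hy
          · exact hy.2.1.le
          · exact hy.1.le
        have hx : Moves c p q x := Or.inl ⟨hl, lt_of_lt_of_le hxy hyq, hrow⟩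
        exact lt_of_lt_of_le (shiftCol_lt_of_moves hpq.1 hx)
          (le_shiftCol_of_moves hy hxy (hrow.le.trans (row_le_ht c x)))
    · push Not at hk
      obtain ⟨k, h1, h2, h3⟩ := hk
      exact lt_of_le_of_lt (shiftCol_le c p q x)
        (lt_of_lt_of_le (Fin.lt_def.1 h1) (le_shiftCol_of_moves hy h2 h3))
  · have : shiftCol c p q y = col c y := by unfold shiftCol; rw [if_neg hy]
    rw [this]
    exact lt_of_le_of_lt (shiftCol_le c p q x) (Fin.lt_def.1 hxy)

/-- The inverse permutation gives positions in the word, which is sorted by column first; the rows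
never matter. -/
theorem columnWord_symm_lt {colOf rowOf : Fin n → ℕ} {x y : Fin n} (h : colOf x < colOf y) :
    (columnWord colOf rowOf).symm x < (columnWord colOf rowOf).symm y := by
  by_contra! hle
  have hm := Tuple.monotone_sort
    (fun x => (toLex (colOf x, OrderDual.toDual (rowOf x)) : ℕ ×ₗ ℕᵒᵈ)) hle
  change toLex (colOf (columnWord colOf rowOf _), _) ≤
    toLex (colOf (columnWord colOf rowOf _), _) at hm
  rw [Equiv.apply_symm_apply, Equiv.apply_symm_apply, Prod.Lex.toLex_le_toLex] at hm
  simp only at hm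
  omega

theorem unitVec_mem_nilInter {w : Equiv.Perm (Fin n)} {i j : Fin n} (h : i < j)
    (hw : w.symm i < w.symm j) : unitVec i j ∈ nilInter w := by
  refine ⟨Submodule.subset_span ⟨i, j, h, rfl⟩,
    unitVec (w.symm i) (w.symm j), Submodule.subset_span ⟨_, _, hw, rfl⟩, ?_⟩
  ext a b
  simp [unitVec, Matrix.single_apply]

theorem unitVec_mem_uPair {c : Composition n} {p q : Fin c.length} (hpq : Neighbours c p q)
    {x y : Fin n} (hxy : col c x < col c y) (h : ¬ Crosses c p q x y) :
    unitVec x y ∈ uPair c p q :=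
  unitVec_mem_nilInter (lt_of_col_lt c hxy)
    (columnWord_symm_lt (shiftCol_lt_shiftCol hpq hxy h))

/-! ### The invariant of the construction -/

/-- A line running to the right which crosses no column shift. -/
def IsUncrossed (c : Composition n) (l : Fin n × Fin n) : Prop :=
  col c l.1 < col c l.2 ∧ ∀ p q, Neighbours c p q → ¬ Crosses c p q l.1 l.2

/-- The shape of the lines labelled `*`: such a line ends in the lowest box of its column and passes
over smaller columns only. -/
structure IsStarShaped (c : Composition n) (l : Fin n × Fin n) : Prop where
  col_lt : col c l.1 < col c l.2
  row_le : row c l.1 ≤ row c l.2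
  row_eq : row c l.2 = ht c (col c l.2)
  between : ∀ k, col c l.1 < k → k < col c l.2 → ht c k < row c l.2

/-- The properties of the system of lines after stage `i`. -/
structure StageInvariant (c : Composition n) (i : ℕ) (S : Lines n) : Prop where
  ones : ∀ l ∈ S.ones, IsUncrossed c l
  stars : ∀ l ∈ S.stars, IsStarShaped c l
  gated : ∀ l ∈ S.gated, row c l.2 < i
  gated_of_stars : ∀ l ∈ S.stars, row c l.2 < i → l ∈ S.gated
  initStar : ∀ l, i < row c l.2 → (l ∈ S.stars ↔ InitStar c l)
  col_unique : ∀ l ∈ S.stars, ∀ m ∈ S.stars, l.2 = m.2 → col c l.1 = col c m.1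

theorem InitStar.isStarShaped {c : Composition n} {l : Fin n × Fin n} (h : InitStar c l) :
    IsStarShaped c l where
  col_lt := h.1.2.1
  row_le := h.1.1.le
  row_eq := h.2.1
  between _ h1 h2 := h.1.1 ▸ h.1.ht_lt h1 h2

/-- Both ends share a row, so the right end cannot be below row s with the left end above. The other
kind of move, that of the lowest box of q, is what the label `*` records. -/
theorem isUncrossed_of_adjacent {c : Composition n} {l : Fin n × Fin n}
    (h : Adjacent c l.1 l.2) (hs : ¬ InitStar c l) : IsUncrossed c l := by
  refine ⟨h.2.1, fun p q hpq hc => ?_⟩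
  obtain ⟨hm | hm, hr, -⟩ := hc
  · have := h.1
    omega
  · exact hs ⟨h, by rw [hm.1]; exact hm.2, p, by rw [hm.1]; exact hpq⟩

theorem stageInvariant_initial (c : Composition n) : StageInvariant c 0 (initial c) where
  ones l hl := by
    simp only [initial, Finset.mem_filter, Finset.mem_univ, true_and] at hl
    exact isUncrossed_of_adjacent hl.1 hl.2
  stars l hl := InitStar.isStarShaped (Finset.mem_filter.1 hl).2
  gated l hl := absurd hl (Finset.notMem_empty l)
  gated_of_stars l _ h := absurd h (Nat.not_lt_zero _)
  initStar l _ := by simp [initial]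
  col_unique l hl m hm h := by
    have h1 := (Finset.mem_filter.1 hl).2.1
    have h2 := (Finset.mem_filter.1 hm).2.1
    rw [← h] at h2
    exact h1.col_eq h2

/-- Column p is as high as q, so the row of y has a box to its left; the nearest one need not lie in
p. -/
theorem exists_initStar {c : Composition n} {p q : Fin c.length} (hpq : Neighbours c p q)
    {y : Fin n} (hy : col c y = q) (hr : row c y = ht c q) : ∃ x, InitStar c (x, y) := by
  obtain ⟨z, hz, hzr⟩ := exists_box c p (row c y) (one_le_row c y) (by rw [hr, hpq.2.1])
  obtain ⟨x, hx⟩ := exists_adjacent hzr (by rw [hz, hy]; exact hpq.1)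
  exact ⟨x, hx, by simpa [hy] using hr, p, by simpa [hy] using hpq⟩

/-! ### One stage preserves the invariant -/

section Stage

variable {c : Composition n} {i : ℕ} {S : Lines n}

theorem StageInvariant.mem_ungated (hS : StageInvariant c i S) {l : Fin n × Fin n} :
    l ∈ ungated c (i + 1) S ↔ l ∈ S.stars ∧ row c l.2 = i := by
  simp only [ungated, Finset.mem_filter, Finset.mem_sdiff]
  constructor
  · rintro ⟨⟨h1, h2⟩, -, h4⟩
    refine ⟨h1, ?_⟩
    by_contra hne
    exact h2 (hS.gated_of_stars l h1 (by omega))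
  · rintro ⟨h1, h2⟩
    have := (hS.stars l h1).row_le
    exact ⟨⟨h1, fun hg => (hS.gated l hg).ne h2⟩, by omega, by omega⟩

theorem StageInvariant.ht_ungated (hS : StageInvariant c i S) {l : Fin n × Fin n}
    (hl : l ∈ ungated c (i + 1) S) : ht c (col c l.2) = i := by
  obtain ⟨h1, h2⟩ := hS.mem_ungated.1 hl
  rw [← (hS.stars l h1).row_eq, h2]

theorem StageInvariant.isStarShaped_ungated (hS : StageInvariant c i S) {l : Fin n × Fin n}
    (hl : l ∈ ungated c (i + 1) S) : IsStarShaped c l :=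
  hS.stars l (hS.mem_ungated.1 hl).1

/-- Of two ungated lines, the one with the left end further to the left ends further to the
left. -/
theorem StageInvariant.col_snd_lt_of_ungated (hS : StageInvariant c i S) {l m : Fin n × Fin n}
    (hl : l ∈ ungated c (i + 1) S) (hm : m ∈ ungated c (i + 1) S)
    (h : col c l.1 < col c m.1) : col c l.2 < col c m.2 := by
  have hsl := hS.isStarShaped_ungated hl
  have hsm := hS.isStarShaped_ungated hm
  have hrl := (hS.mem_ungated.1 hl).2
  have hrm := (hS.mem_ungated.1 hm).2
  rcases lt_trichotomy (col c l.2) (col c m.2) with h1 | h1 | h1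
  · exact h1
  · exact absurd (hS.col_unique l (hS.mem_ungated.1 hl).1 m (hS.mem_ungated.1 hm).1
      (box_ext c h1 (hrl.trans hrm.symm))) h.ne
  · have := hsl.between _ (h.trans hsm.col_lt) h1
    have := hS.ht_ungated hm
    omega

theorem mem_deleted {l : Fin n × Fin n} : l ∈ deleted c i S ↔ Adjacent c l.1 l.2 ∧
    row c l.1 = i ∧ ∃ m ∈ ungated c i S, col c l.1 ≤ col c m.1 ∧ col c m.2 ≤ col c l.2 := by
  simp [deleted]

theorem StageInvariant.isStarShaped_newStars (hS : StageInvariant c i S) {l : Fin n × Fin n}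
    (hl : l ∈ newStars c (i + 1) S) : IsStarShaped c l := by
  obtain ⟨hl, x, hd, hs⟩ := Finset.mem_filter.1 hl
  obtain ⟨-, ⟨hfr, -⟩, ⟨b, hb, hbl⟩, hlt, hmax⟩ := Finset.mem_filter.1 hl
  obtain ⟨hadj, hrow, m, hm, h3, h4⟩ := mem_deleted.1 hd
  have hsx := hS.stars _ hs
  have hsb := hS.isStarShaped_ungated hb
  refine ⟨hlt, ?_, hsx.row_eq, fun k h1 h2 => hsx.between k ?_ h2⟩
  · have := hsb.row_le
    have := (hS.mem_ungated.1 hb).2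
    rw [← hbl]
    omega
  -- By maximality the new left end is no further left than x, so fewer columns are passed over.
  · exact lt_of_le_of_lt
      (h3.trans (hmax m hm (lt_of_lt_of_le (hS.isStarShaped_ungated hm).col_lt h4))) h1

/-- If y lies below row s, then s ≤ i and the column of b', of height i, would have to lie at or
beyond y; but the column of y is higher than i, and the line b — b' passes over smaller columns
only. -/
theorem StageInvariant.isUncrossed_joinEven (hS : StageInvariant c i S) {l : Fin n × Fin n}
    (hl : l ∈ joinEven c (i + 1) S) (hn : l ∉ newStars c (i + 1) S) : IsUncrossed c l := by
  obtain ⟨-, ⟨hfr, hfree⟩, ⟨b, hb, hbl⟩, hlt, hmax⟩ := Finset.mem_filter.1 hl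
  have hsb := hS.isStarShaped_ungated hb
  have hrb := (hS.mem_ungated.1 hb).2
  have hhb := hS.ht_ungated hb
  have hhy := row_le_ht c l.2
  refine ⟨hlt, fun p q hpq hc => ?_⟩
  obtain ⟨hm | hm, -, hk⟩ := hc
  · rcases lt_trichotomy (col c b.2) (col c l.2) with h1 | h1 | h1
    · have := hk _ (hbl ▸ hsb.col_lt) h1
      omega
    · rw [h1] at hhb
      omega
    · have := hsb.between _ (hbl ▸ hlt) h1
      omega
  -- Row i + 1 still carries its initial stars, so the line deleted at y was labelled `*`.
  · obtain ⟨x, hx⟩ := exists_initStar hpq hm.1 hm.2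
    exact hn (Finset.mem_filter.2 ⟨hl, x, hfree x hx.1,
      (hS.initStar (x, l.2) (by simp only; omega)).2 hx⟩)

theorem StageInvariant.isUncrossed_joinOdd (hS : StageInvariant c i S) {l : Fin n × Fin n}
    (hl : l ∈ joinOdd c (i + 1) S) : IsUncrossed c l := by
  obtain ⟨-, ⟨hfr, -⟩, ⟨b, hb, hbl⟩, hlt, -⟩ := Finset.mem_filter.1 hl
  have hrb := (hS.mem_ungated.1 hb).2
  have hhb := hS.ht_ungated hb
  rw [hbl] at hrb hhb
  refine ⟨hlt, fun p q hpq hc => ?_⟩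
  obtain ⟨hm | hm, hr, -⟩ := hc
  · omega
  · rw [hm.1] at hhb
    have := hpq.2.1
    omega

/-- The right end of the first line lies strictly between, in a column of height i, whereas a moving
box at the bottom of a column of height i forces s ≤ i. -/
theorem StageInvariant.isUncrossed_joinLoose (hS : StageInvariant c i S) {l : Fin n × Fin n}
    (hl : l ∈ joinLoose c (i + 1) S) : IsUncrossed c l := by
  obtain ⟨-, m, hm, m', hm', rfl, hlt, -, -⟩ := Finset.mem_filter.1 hl
  have hlt2 := hS.col_snd_lt_of_ungated hm hm' hlt
  have hsm := hS.isStarShaped_ungated hm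
  refine ⟨hsm.col_lt.trans hlt2, fun p q hpq hc => ?_⟩
  obtain ⟨hmv, -, hk⟩ := hc
  have h1 := hk _ hsm.col_lt hlt2
  have h2 := hS.ht_ungated hm
  have h3 := (hS.mem_ungated.1 hm').2
  have h4 := hS.ht_ungated hm'
  have h5 := hpq.2.1
  simp only at hmv
  rcases hmv with hmv | hmv
  · omega
  · rw [hmv.1] at h4
    omega

theorem row_of_mem_newStars {l : Fin n × Fin n}
    (hl : l ∈ newStars c i S) : row c l.2 = i :=
  (Finset.mem_filter.1 (Finset.mem_filter.1 hl).1).2.1.1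

theorem mem_stars_performStage {l : Fin n × Fin n} :
    l ∈ (performStage c i S).stars ↔
      (l ∈ S.stars ∧ l ∉ deleted c i S) ∨ l ∈ newStars c i S := by
  simp [performStage]

/-- A `*` line of S ending in row i + 1 is still horizontal, and a new star ends there only if that
line was deleted. -/
theorem StageInvariant.not_newStars_of_snd_eq (hS : StageInvariant c i S)
    {l m : Fin n × Fin n} (hl : l ∈ S.stars) (hd : l ∉ deleted c (i + 1) S)
    (h : l.2 = m.2) : m ∉ newStars c (i + 1) S := by
  intro hm
  have hr := row_of_mem_newStars hm
  obtain ⟨-, ⟨-, hfree⟩, -⟩ := Finset.mem_filter.1 (Finset.mem_filter.1 hm).1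
  have hI := (hS.initStar l (by rw [h]; omega)).1 hl
  exact hd (by simpa [← h] using hfree l.1 (by rw [← h]; exact hI.1))

theorem StageInvariant.performStage (hS : StageInvariant c i S) :
    StageInvariant c (i + 1) (performStage c (i + 1) S) where
  ones l hl := by
    simp only [MaxGating.performStage, Finset.mem_union, Finset.mem_sdiff] at hl
    rcases hl with ((hl | hl) | hl) | hl
    · exact hS.ones l hl.1
    · exact hS.isUncrossed_joinEven hl.1 hl.2
    · exact hS.isUncrossed_joinOdd hl
    · exact hS.isUncrossed_joinLoose hl
  stars l hl := by
    rcases mem_stars_performStage.1 hl with hl | hl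
    · exact hS.stars l hl.1
    · exact hS.isStarShaped_newStars hl
  gated l hl := by
    rcases Finset.mem_union.1 hl with hl | hl
    · exact (hS.gated l hl).trans (Nat.lt_succ_self i)
    · exact Nat.lt_succ_of_le (hS.mem_ungated.1 hl).2.le
  gated_of_stars l hl hr := by
    rcases mem_stars_performStage.1 hl with hl | hl
    · rcases Nat.lt_succ_iff_lt_or_eq.1 hr with hr | hr
      · exact Finset.mem_union_left _ (hS.gated_of_stars l hl.1 hr)
      · exact Finset.mem_union_right _ (hS.mem_ungated.2 ⟨hl.1, hr⟩)
    · exact absurd (row_of_mem_newStars hl) hr.ne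
  initStar l hr := by
    rw [mem_stars_performStage, ← hS.initStar l (by omega)]
    constructor
    · rintro (h | h)
      · exact h.1
      · exact absurd (row_of_mem_newStars h) hr.ne'
    · refine fun h => Or.inl ⟨h, fun hd => ?_⟩
      have h1 := mem_deleted.1 hd
      exact hr.ne (h1.2.1.symm.trans h1.1.1)
  col_unique l hl m hm h := by
    rcases mem_stars_performStage.1 hl with hl | hl <;>
      rcases mem_stars_performStage.1 hm with hm | hm
    · exact hS.col_unique l hl.1 m hm.1 h
    · exact absurd hm (hS.not_newStars_of_snd_eq hl.1 hl.2 h)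
    · exact absurd hl (hS.not_newStars_of_snd_eq hm.1 hm.2 h.symm)
    · obtain ⟨-, -, ⟨b, hb, hbl⟩, hlt, hmax⟩ :=
        Finset.mem_filter.1 (Finset.mem_filter.1 hl).1
      obtain ⟨-, -, ⟨b', hb', hbm⟩, hlt', hmax'⟩ :=
        Finset.mem_filter.1 (Finset.mem_filter.1 hm).1
      apply le_antisymm
      · exact hbl ▸ hmax' b hb (by rw [hbl, ← h]; exact hlt)
      · exact hbm ▸ hmax b' hb' (by rw [hbm, h]; exact hlt')

end Stage

/-! ### The final system and the element `e` -/

theorem stageInvariant_stage (c : Composition n) (i : ℕ) : StageInvariant c i (stage c i) := by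
  induction i with
  | zero => exact stageInvariant_initial c
  | succ i ih => exact ih.performStage

theorem isUncrossed_of_mem_finalLines {c : Composition n} {l : Fin n × Fin n}
    (hl : l ∈ (finalLines c).ones) : IsUncrossed c l :=
  (stageInvariant_stage c (n + 1)).ones l hl

theorem mem_finalLines_of_e_ne_zero {c : Composition n} {i j : Fin n} (h : e c i j ≠ 0) :
    (i, j) ∈ (finalLines c).ones := by
  by_contra hne
  refine h ?_
  unfold e
  rw [Matrix.sum_apply]
  refine Finset.sum_eq_zero fun l hl => ?_
  have : ¬ (l.1 = i ∧ l.2 = j) := by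
    rintro ⟨rfl, rfl⟩
    exact hne hl
  simp [unitVec, this]

end MaxGating

theorem proposition6p9p2 {n : ℕ} (c : Composition n) :
    MaxGating.spanE c ≤ MaxGating.uPi c ∧
      ∀ i j : Fin n, (i, j) ∈ (MaxGating.finalLines c).ones →
        ∀ p q : Fin c.length, MaxGating.Neighbours c p q → ¬ MaxGating.Excluded c p q i j := by
  have key : ∀ i j : Fin n, (i, j) ∈ (MaxGating.finalLines c).ones →
      ∀ p q : Fin c.length, MaxGating.Neighbours c p q →
        MaxGating.unitVec i j ∈ MaxGating.uPair c p q := fun i j hij p q hpq =>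
    have h := MaxGating.isUncrossed_of_mem_finalLines hij
    MaxGating.unitVec_mem_uPair hpq h.1 (h.2 p q hpq)
  refine ⟨Submodule.span_le.2 ?_, fun i j hij p q hpq hex => hex.2 (key i j hij p q hpq)⟩
  rintro _ ⟨i, j, hij, rfl⟩
  have hij := MaxGating.mem_finalLines_of_e_ne_zero hij
  refine ⟨Submodule.subset_span
    ⟨i, j, (MaxGating.isUncrossed_of_mem_finalLines hij).1, rfl⟩, ?_⟩
  simp only [SetLike.mem_coe, Submodule.mem_iInf]
  exact key i j hij
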